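/- All manifolds, metrics, maps and functions are smooth. For a map $\varphi:(M^m,g)\to(N^n,h)$ between Riemannian manifolds let $\nabla^{\varphi}$ be the pull-back to $\varphi^{-1}TN$ of the Levi-Civita connection of $h$, let $R^N(X,Y)Z=[\nabla^N_X,\nabla^N_Y]Z-\nabla^N_{[X,Y]}Z$, let $\tau(\varphi,g)=\mathrm{Trace}_g\nabla d\varphi$ be the tension field, and for a vector field $X$ along $\varphi$ let $$J^{\varphi}_g(X)=-\big\{\mathrm{Trace}_g(\nabla^{\varphi}\nabla^{\varphi}-\nabla^{\varphi}_{\nabla^M})X-\mathrm{Trace}_g R^N(d\varphi,X)d\varphi\big\}$$ be the Jacobi operator. The map $\varphi$ is harmonic if $\tau(\varphi,g)=0$ identically, and biharmonic if its bitension field $$\tau^2(\varphi,g)=\mathrm{Trace}_g(\nabla^{\varphi}\nabla^{\varphi}-\nabla^{\varphi}_{\nabla^M})\tau(\varphi,g)-\mathrm{Trace}_g R^N(d\varphi,\tau(\varphi,g))d\varphi$$ vanishes identically (the biharmonic map equation). **Corollary.** Let $\varphi:(M^m,g)\to(N^n,h)$ be a harmonic map with $m\neq 2$, and let $\bar g=F^{-2}g$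 be a conformal change of the metric $g$, where $F:M\to(0,\infty)$ is smooth. Then $\varphi:(M^m,\bar g)\to(N^n,h)$ is biharmonic if and only if, everywhere on $M$, $$J^{\varphi}_g\big(d\varphi(\mathrm{grad}\ln F)\big)+(m-6)\,\nabla^{\varphi}_{\mathrm{grad}\ln F}\,d\varphi(\mathrm{grad}\ln F)-2\big(\Delta\ln F-(m-4)|\mathrm{grad}\ln F|^2\big)\,d\varphi(\mathrm{grad}\ln F)=0,$$ where $\mathrm{grad}$, $\Delta=\mathrm{Trace}_g\nabla d$ and $|\cdot|$ are taken with respect to $g$. -/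

import Mathlib

open scoped Manifold ContDiff Bundle

noncomputable section

namespace RiemannianMaps

/-- A smooth Riemannian metric on a smooth manifold modelled on `ℝᵐ` (without boundary). -/
abbrev Metric (m : ℕ) (M : Type*) [TopologicalSpace M] [ChartedSpace (EuclideanSpace ℝ (Fin m)) M]
    [IsManifold (𝓡 m) ∞ M] :=
  Bundle.ContMDiffRiemannianMetric (𝓡 m) ∞ (EuclideanSpace ℝ (Fin m))
    (TangentSpace (𝓡 m) : M → Type _)

section Coordinates

variable {m : ℕ} {M : Type*} [TopologicalSpace M] [ChartedSpace (EuclideanSpace ℝ (Fin m)) M]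
  [IsManifold (𝓡 m) ∞ M]

/-- The partial derivative `∂ᵢ f` at the point `y` of `ℝᵐ`. -/
def partialDeriv {V : Type*} [NormedAddCommGroup V] [NormedSpace ℝ V] (i : Fin m)
    (f : EuclideanSpace ℝ (Fin m) → V) (y : EuclideanSpace ℝ (Fin m)) : V :=
  fderiv ℝ f y (EuclideanSpace.single i 1)

/-- The components of a tangent vector `v` at `x` in the chart of `M` around `p`. -/
def toCoord (p x : M) (v : TangentSpace (𝓡 m) x) : EuclideanSpace ℝ (Fin m) :=
  (trivializationAt (EuclideanSpace ℝ (Fin m)) (TangentSpace (𝓡 m) : M → Type _) p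
    ⟨x, v⟩).2

/-- The tangent vector at `x` with the given components in the chart of `M` around `p`
(for `x` in the domain of this chart). -/
def ofCoord (p x : M) (w : EuclideanSpace ℝ (Fin m)) : TangentSpace (𝓡 m) x :=
  (trivializationAt (EuclideanSpace ℝ (Fin m)) (TangentSpace (𝓡 m) : M → Type _) p).symm x w

/-- The matrix `g_{ij} = g(∂ᵢ, ∂ⱼ)` of the metric in the chart around `p`, as a function on the
target of the chart. -/
def metricMatrix (g : Metric m M) (p : M) (y : EuclideanSpace ℝ (Fin m)) :
    Matrix (Fin m) (Fin m) ℝ :=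
  Matrix.of fun i j =>
    g.inner ((extChartAt (𝓡 m) p).symm y)
      (ofCoord p _ (EuclideanSpace.single i 1)) (ofCoord p _ (EuclideanSpace.single j 1))

/-- The components `g^{ij}` of the inverse metric in the chart around `p`. -/
def invMetricMatrix (g : Metric m M) (p : M) (y : EuclideanSpace ℝ (Fin m)) :
    Matrix (Fin m) (Fin m) ℝ :=
  (metricMatrix g p y)⁻¹

/-- The Christoffel symbols of the Levi-Civita connection in the chart around `p`:
`christoffel g p i j k y = Γᵏᵢⱼ(y) = ½ ∑ₗ gᵏˡ (∂ᵢ gⱼₗ + ∂ⱼ gᵢₗ - ∂ₗ gᵢⱼ)`. -/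
def christoffel (g : Metric m M) (p : M) (i j k : Fin m) (y : EuclideanSpace ℝ (Fin m)) : ℝ :=
  (1 / 2 : ℝ) * ∑ l, invMetricMatrix g p y k l *
    (partialDeriv i (fun z => metricMatrix g p z j l) y
      + partialDeriv j (fun z => metricMatrix g p z i l) y
      - partialDeriv l (fun z => metricMatrix g p z i j) y)

/-- The components of the curvature tensor `R(X,Y)Z = [∇_X,∇_Y]Z - ∇_{[X,Y]}Z` in the chart around
`p`: `R(∂ₐ,∂_b)∂_c = ∑_d curvature g p a b c d ∂_d`. -/
def curvature (g : Metric m M) (p : M) (a b c d : Fin m) (y : EuclideanSpace ℝ (Fin m)) : ℝ :=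
  partialDeriv a (christoffel g p b c d) y - partialDeriv b (christoffel g p a c d) y
    + ∑ e, (christoffel g p a e d y * christoffel g p b c e y
        - christoffel g p b e d y * christoffel g p a c e y)

/-- The scalar product `g` at `x` as a bilinear form. -/
def bilinAt (g : Metric m M) (x : M) : LinearMap.BilinForm ℝ (TangentSpace (𝓡 m) x) :=
  LinearMap.mk₂ ℝ (fun v w => g.inner x v w) (by simp) (by simp) (by simp) (by simp)

theorem bilinAt_nondegenerate (g : Metric m M) (x : M) : (bilinAt g x).Nondegenerate := by
  have key : ∀ v : TangentSpace (𝓡 m) x, g.inner x v v = 0 → v = 0 := by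
    intro v h
    by_contra hv
    exact (g.pos x v hv).ne' h
  exact ⟨fun v h => key v (h v), fun v h => key v (h v)⟩

instance (x : M) : FiniteDimensional ℝ (TangentSpace (𝓡 m) x) :=
  inferInstanceAs (FiniteDimensional ℝ (EuclideanSpace ℝ (Fin m)))

/-- The gradient of a function: the tangent vector at `x` with `g(grad f, w) = df(w)`
for all `w`. -/
def grad (g : Metric m M) (f : M → ℝ) (x : M) : TangentSpace (𝓡 m) x :=
  ((bilinAt g x).toDual (bilinAt_nondegenerate g x)).symm
    (mfderiv (𝓡 m) 𝓘(ℝ, ℝ) f x).toLinearMap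

/-- The Laplacian `Δf = Trace_g ∇df = ∑ gⁱʲ (∂ᵢ∂ⱼ f - ∑ₖ Γᵏᵢⱼ ∂ₖ f)`, computed at `x` in the chart
around `x`. -/
def laplacian (g : Metric m M) (f : M → ℝ) (x : M) : ℝ :=
  let y := extChartAt (𝓡 m) x x
  let fc : EuclideanSpace ℝ (Fin m) → ℝ := f ∘ (extChartAt (𝓡 m) x).symm
  ∑ i, ∑ j, invMetricMatrix g x y i j *
    (partialDeriv i (partialDeriv j fc) y - ∑ k, christoffel g x i j k y * partialDeriv k fc y)

set_option synthInstance.maxHeartbeats 400000 in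
/-- The conformal metric `F⁻² g`, for a smooth positive function `F`. -/
def conformalChange (g : Metric m M) (F : M → ℝ) (hF : ContMDiff (𝓡 m) 𝓘(ℝ, ℝ) ∞ F)
    (hpos : ∀ x, 0 < F x) : Metric m M where
  inner x := (F x ^ 2)⁻¹ • g.inner x
  symm x v w := by simp [g.symm x v w]
  pos x v hv := by
    have := g.pos x v hv
    have := hpos x
    simp only [FunLike.coe_smul, Pi.smul_apply, smul_eq_mul]
    positivity
  isVonNBounded x := by
    have hx := hpos x
    refine ((g.isVonNBounded x).image (F x • ContinuousLinearMap.id ℝ _)).subset fun v hv => ?_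
    refine ⟨(F x)⁻¹ • v, ?_, by simp [smul_smul, hx.ne']⟩
    have e : (F x)⁻¹ * ((F x)⁻¹ * g.inner x v v) = (F x ^ 2)⁻¹ * g.inner x v v := by ring
    have hv' : (F x ^ 2)⁻¹ * g.inner x v v < 1 := hv
    simpa [e] using hv'
  contMDiff := by
    refine ContMDiff.smul_section ?_ g.contMDiff
    exact (hF.pow 2).inv₀ fun x => (pow_pos (hpos x) 2).ne'

end Coordinates

section Maps

variable {m n : ℕ} {M N : Type*}
  [TopologicalSpace M] [ChartedSpace (EuclideanSpace ℝ (Fin m)) M] [IsManifold (𝓡 m) ∞ M]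
  [TopologicalSpace N] [ChartedSpace (EuclideanSpace ℝ (Fin n)) N] [IsManifold (𝓡 n) ∞ N]

/-- The map `φ : M → N` in the charts around `p` and `φ p`. -/
def mapCoord (φ : M → N) (p : M) : EuclideanSpace ℝ (Fin m) → EuclideanSpace ℝ (Fin n) :=
  writtenInExtChartAt (𝓡 m) (𝓡 n) p φ

/-- A vector field along `φ`: a section of `φ⁻¹TN`. -/
abbrev FieldAlong (n : ℕ) {M N : Type*} [TopologicalSpace N]
    [ChartedSpace (EuclideanSpace ℝ (Fin n)) N] (φ : M → N) :=
  (x : M) → TangentSpace (𝓡 n) (φ x)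

/-- The components of a vector field along `φ` in the charts around `p` and `φ p`. -/
def fieldCoord {φ : M → N} (X : FieldAlong n φ) (p : M) :
    EuclideanSpace ℝ (Fin m) → EuclideanSpace ℝ (Fin n) :=
  fun y => toCoord (φ p) (φ ((extChartAt (𝓡 m) p).symm y)) (X ((extChartAt (𝓡 m) p).symm y))

/-- The covariant derivative `∇ᵠ_{∂ᵢ}` for the pull-back of the Levi-Civita connection of `h`,
acting on the components `X` of a vector field along `φ` in the charts around `p` and `φ p`:
`(∇ᵠ_{∂ᵢ} X)ᶜ = ∂ᵢ Xᶜ + ∑ Γᶜ_{ab}(φ) ∂ᵢφᵃ Xᵇ`. -/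
def covDerivCoord (h : Metric n N) (φ : M → N) (p : M) (i : Fin m)
    (X : EuclideanSpace ℝ (Fin m) → EuclideanSpace ℝ (Fin n)) :
    EuclideanSpace ℝ (Fin m) → EuclideanSpace ℝ (Fin n) :=
  fun y => partialDeriv i X y + WithLp.toLp 2 fun c => ∑ a, ∑ b,
    christoffel h (φ p) a b c (mapCoord φ p y) * partialDeriv i (mapCoord φ p) y a * X y b

/-- The covariant derivative `∇ᵠ_v X` at `p`, for a tangent vector `v` of `M` at `p` and a vector
field `X` along `φ`. -/
def covDeriv (h : Metric n N) {φ : M → N} (X : FieldAlong n φ) (p : M)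
    (v : TangentSpace (𝓡 m) p) : TangentSpace (𝓡 n) (φ p) :=
  ofCoord (φ p) (φ p) (∑ i, toCoord p p v i •
    covDerivCoord h φ p i (fieldCoord X p) (extChartAt (𝓡 m) p p))

/-- The rough Laplacian `Trace_g (∇ᵠ∇ᵠ - ∇ᵠ_{∇ᴹ}) X`, which is
`∑ gⁱʲ (∇ᵠ_{∂ᵢ} ∇ᵠ_{∂ⱼ} X - ∇ᵠ_{∇ᴹ_{∂ᵢ} ∂ⱼ} X)` in coordinates. -/
def roughLaplacian (g : Metric m M) (h : Metric n N) {φ : M → N} (X : FieldAlong n φ) :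
    FieldAlong n φ :=
  fun p =>
    let y := extChartAt (𝓡 m) p p
    ofCoord (φ p) (φ p) (∑ i, ∑ j, invMetricMatrix g p y i j •
      (covDerivCoord h φ p i (covDerivCoord h φ p j (fieldCoord X p)) y
        - ∑ k, christoffel g p i j k y • covDerivCoord h φ p k (fieldCoord X p) y))

/-- The field `Trace_g Rᴺ(dφ, X)dφ = ∑ gⁱʲ Rᴺ(dφ(∂ᵢ), X) dφ(∂ⱼ)` along `φ`. -/
def curvatureTrace (g : Metric m M) (h : Metric n N) {φ : M → N} (X : FieldAlong n φ) :
    FieldAlong n φ :=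
  fun p =>
    let y := extChartAt (𝓡 m) p p
    ofCoord (φ p) (φ p) (∑ i, ∑ j, invMetricMatrix g p y i j • WithLp.toLp 2 fun d =>
      ∑ a, ∑ b, ∑ c, curvature h (φ p) a b c d (mapCoord φ p y)
        * partialDeriv i (mapCoord φ p) y a * fieldCoord X p y b
        * partialDeriv j (mapCoord φ p) y c)

/-- The Jacobi operator
`J(X) = -(Trace_g (∇ᵠ∇ᵠ - ∇ᵠ_{∇ᴹ}) X - Trace_g Rᴺ(dφ, X)dφ)` of `φ`. -/
def jacobi (g : Metric m M) (h : Metric n N) {φ : M → N} (X : FieldAlong n φ) :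
    FieldAlong n φ :=
  fun p => -(roughLaplacian g h X p - curvatureTrace g h X p)

/-- The tension field `τ(φ) = Trace_g ∇dφ`, which is
`∑ gⁱʲ (∇ᵠ_{∂ᵢ} (dφ(∂ⱼ)) - dφ(∇ᴹ_{∂ᵢ} ∂ⱼ))` in coordinates. -/
def tension (g : Metric m M) (h : Metric n N) (φ : M → N) : FieldAlong n φ :=
  fun p =>
    let y := extChartAt (𝓡 m) p p
    ofCoord (φ p) (φ p) (∑ i, ∑ j, invMetricMatrix g p y i j •
      (covDerivCoord h φ p i (partialDeriv j (mapCoord φ p)) y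
        - ∑ k, christoffel g p i j k y • partialDeriv k (mapCoord φ p) y))

/-- The bitension field
`τ²(φ) = Trace_g (∇ᵠ∇ᵠ - ∇ᵠ_{∇ᴹ}) τ(φ) - Trace_g Rᴺ(dφ, τ(φ))dφ`. -/
def bitension (g : Metric m M) (h : Metric n N) (φ : M → N) : FieldAlong n φ :=
  fun p => roughLaplacian g h (tension g h φ) p - curvatureTrace g h (tension g h φ) p

/-- `φ : (M, g) → (N, h)` is harmonic: its tension field vanishes identically. -/
def IsHarmonic (g : Metric m M) (h : Metric n N) (φ : M → N) : Prop :=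
  ∀ p, tension g h φ p = 0

/-- `φ : (M, g) → (N, h)` is biharmonic: it satisfies the biharmonic map equation, that is, its
bitension field vanishes identically. -/
def IsBiharmonic (g : Metric m M) (h : Metric n N) (φ : M → N) : Prop :=
  ∀ p, bitension g h φ p = 0

/-- The vector field `dφ(grad f)` along `φ`. -/
def pushGrad (g : Metric m M) (φ : M → N) (f : M → ℝ) : FieldAlong n φ :=
  fun x => mfderiv (𝓡 m) (𝓡 n) φ x (grad g f x)

end Maps

end RiemannianMaps

end

noncomputable section

namespace RiemannianMaps

/-! ### Tangent vectors and the metric in a chart -/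

section TangentCoordinates

variable {m : ℕ} {M : Type*} [TopologicalSpace M] [ChartedSpace (EuclideanSpace ℝ (Fin m)) M]
  [IsManifold (𝓡 m) ∞ M]

/-! Write f = ln F. The metric F⁻²g has inverse matrix e^{2f} gⁱʲ, and its Christoffel symbols are
Γᵏᵢⱼ - (∂ᵢf δᵏⱼ + ∂ⱼf δᵏᵢ - gᵢⱼ (grad f)ᵏ). Tracing gives the one fact about conformal change that
matters: every trace of a second covariant derivative changes by the rule Trace ∇² ↦ F² (Trace ∇² -
(m-2) ∇_{grad f}) (`sum_invMetricMatrix_smul_conformalChange`).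

Applied to dφ, the rule shows that the new tension field of a harmonic map is -(m-2) F² X with X =
dφ(grad f) (`tension_conformalChange`). Applied to the rough Laplacian of c F² X = c e^{2f} X,
together with the Leibniz rule, it gives `roughLaplacian_conformalChange_smul`; the curvature term
only scales by F⁴. Hence the new bitension field is (m-2) F⁴ times the left-hand side of the
asserted equation (`bitension_conformalChange`), and this factor never vanishes when m ≠ 2.

The bitension field at p differentiates the tension field near p in the chart around p, whereas the
tension field at x is defined in the chart around x. Chart independence of the tension field is not
needed: each chart yields -(m-2) F² dφ(grad f) at its own centre, and this expression is intrinsic,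
with smooth components in the chart around p. -/

theorem mem_baseSet_of_mem_source {p x : M} (hx : x ∈ (extChartAt (𝓡 m) p).source) :
    x ∈ (trivializationAt (EuclideanSpace ℝ (Fin m))
      (TangentSpace (𝓡 m) : M → Type _) p).baseSet := by
  rw [extChartAt_source] at hx
  exact hx

theorem ofCoord_eq_symmL {p x : M} (hx : x ∈ (extChartAt (𝓡 m) p).source)
    (w : EuclideanSpace ℝ (Fin m)) :
    ofCoord p x w = (trivializationAt (EuclideanSpace ℝ (Fin m))
      (TangentSpace (𝓡 m) : M → Type _) p).symmL ℝ x w :=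
  (Bundle.Trivialization.symmL_apply (R := ℝ) _ (mem_baseSet_of_mem_source hx) w).symm

theorem toCoord_eq_continuousLinearMapAt {p x : M} (hx : x ∈ (extChartAt (𝓡 m) p).source)
    (v : TangentSpace (𝓡 m) x) :
    toCoord p x v = (trivializationAt (EuclideanSpace ℝ (Fin m))
      (TangentSpace (𝓡 m) : M → Type _) p).continuousLinearMapAt ℝ x v := by
  rw [Bundle.Trivialization.continuousLinearMapAt_apply,
    Bundle.Trivialization.linearMapAt_apply, if_pos (mem_baseSet_of_mem_source hx)]
  rfl

theorem ofCoord_smul {p x : M} (hx : x ∈ (extChartAt (𝓡 m) p).source) (a : ℝ)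
    (w : EuclideanSpace ℝ (Fin m)) : ofCoord p x (a • w) = a • ofCoord p x w := by
  simp only [ofCoord_eq_symmL hx, map_smul]

theorem ofCoord_add {p x : M} (hx : x ∈ (extChartAt (𝓡 m) p).source)
    (v w : EuclideanSpace ℝ (Fin m)) :
    ofCoord p x (v + w) = ofCoord p x v + ofCoord p x w := by
  simp only [ofCoord_eq_symmL hx, map_add]

theorem ofCoord_sub {p x : M} (hx : x ∈ (extChartAt (𝓡 m) p).source)
    (v w : EuclideanSpace ℝ (Fin m)) :
    ofCoord p x (v - w) = ofCoord p x v - ofCoord p x w := by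
  simp only [ofCoord_eq_symmL hx, map_sub]

theorem ofCoord_sum {ι : Type*} (s : Finset ι) {p x : M}
    (hx : x ∈ (extChartAt (𝓡 m) p).source) (w : ι → EuclideanSpace ℝ (Fin m)) :
    ofCoord p x (∑ i ∈ s, w i) = ∑ i ∈ s, ofCoord p x (w i) := by
  simp only [ofCoord_eq_symmL hx, map_sum]

theorem toCoord_smul {p x : M} (hx : x ∈ (extChartAt (𝓡 m) p).source) (a : ℝ)
    (v : TangentSpace (𝓡 m) x) : toCoord p x (a • v) = a • toCoord p x v := by
  simp only [toCoord_eq_continuousLinearMapAt hx, map_smul]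

theorem toCoord_ofCoord {p x : M} (hx : x ∈ (extChartAt (𝓡 m) p).source)
    (w : EuclideanSpace ℝ (Fin m)) : toCoord p x (ofCoord p x w) = w := by
  rw [toCoord_eq_continuousLinearMapAt hx, ofCoord_eq_symmL hx]
  exact Bundle.Trivialization.continuousLinearMapAt_symmL _ (mem_baseSet_of_mem_source hx) w

theorem ofCoord_toCoord {p x : M} (hx : x ∈ (extChartAt (𝓡 m) p).source)
    (v : TangentSpace (𝓡 m) x) : ofCoord p x (toCoord p x v) = v := by
  rw [toCoord_eq_continuousLinearMapAt hx, ofCoord_eq_symmL hx]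
  exact Bundle.Trivialization.symmL_continuousLinearMapAt _ (mem_baseSet_of_mem_source hx) v

theorem ofCoord_eq_sum {p x : M} (hx : x ∈ (extChartAt (𝓡 m) p).source)
    (w : EuclideanSpace ℝ (Fin m)) :
    ofCoord p x w = ∑ i, w i • ofCoord p x (EuclideanSpace.single i 1) := by
  simp only [← ofCoord_smul hx, ← ofCoord_sum _ hx]
  congr 1
  ext j
  simp [Pi.single_apply]

/-- The trivializations of the tangent bundle are derivatives of charts; this and its counterpart
for `ofCoord` turn component computations into the chain rule. -/
theorem toCoord_eq_mfderiv {p x : M} (hx : x ∈ (extChartAt (𝓡 m) p).source)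
    (v : TangentSpace (𝓡 m) x) :
    toCoord p x v = mfderiv (𝓡 m) 𝓘(ℝ, EuclideanSpace ℝ (Fin m)) (extChartAt (𝓡 m) p) x v := by
  rw [toCoord_eq_continuousLinearMapAt hx]
  rw [extChartAt_source] at hx
  rw [TangentBundle.continuousLinearMapAt_trivializationAt hx]
  rfl

theorem ofCoord_eq_mfderiv {p : M} {y : EuclideanSpace ℝ (Fin m)}
    (hy : y ∈ (extChartAt (𝓡 m) p).target) (w : EuclideanSpace ℝ (Fin m)) :
    ofCoord p ((extChartAt (𝓡 m) p).symm y) w =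
      mfderiv 𝓘(ℝ, EuclideanSpace ℝ (Fin m)) (𝓡 m) (extChartAt (𝓡 m) p).symm y w := by
  have hx := (extChartAt (𝓡 m) p).map_target hy
  rw [ofCoord_eq_symmL hx]
  rw [extChartAt_source] at hx
  rw [TangentBundle.symmL_trivializationAt hx, (extChartAt (𝓡 m) p).right_inv hy,
    ModelWithCorners.range_eq_univ, mfderivWithin_univ]
  rfl

/-- In the trivialization around p this section is constant. -/
theorem contMDiffOn_ofCoord (p : M) (w : EuclideanSpace ℝ (Fin m)) :
    ContMDiffOn (𝓡 m) ((𝓡 m).prod 𝓘(ℝ, EuclideanSpace ℝ (Fin m))) ∞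
      (fun x => Bundle.TotalSpace.mk' (EuclideanSpace ℝ (Fin m))
        (E := (TangentSpace (𝓡 m) : M → Type _)) x (ofCoord p x w))
      (extChartAt (𝓡 m) p).source := by
  rw [Bundle.Trivialization.contMDiffOn_section_iff (trivializationAt (EuclideanSpace ℝ (Fin m))
    (TangentSpace (𝓡 m) : M → Type _) p) (isOpen_extChartAt_source p)
    fun x hx => mem_baseSet_of_mem_source hx]
  exact (contMDiffOn_const (c := w)).congr fun x hx => toCoord_ofCoord hx w

theorem contDiffOn_metricMatrix (g : Metric m M) (p : M) (i j : Fin m) :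
    ContDiffOn ℝ ∞ (fun y => metricMatrix g p y i j) (extChartAt (𝓡 m) p).target := by
  -- With g as the inner product of the fibres, smoothness of gᵢⱼ is smoothness of the inner product
  -- of two smooth sections.
  let : Bundle.RiemannianBundle (TangentSpace (𝓡 m) : M → Type _) := ⟨g.toRiemannianMetric⟩
  have hs (k : Fin m) := contMDiffOn_ofCoord p (EuclideanSpace.single k (1 : ℝ))
  have hg := ContMDiffOn.inner_bundle (hs i) (hs j)
  rw [← contMDiffOn_iff_contDiffOn]
  exact hg.comp (contMDiffOn_extChartAt_symm p) fun y hy => (extChartAt (𝓡 m) p).map_target hy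

theorem inner_ofCoord_single (g : Metric m M) {p : M} {y : EuclideanSpace ℝ (Fin m)}
    (hy : y ∈ (extChartAt (𝓡 m) p).target) (v : EuclideanSpace ℝ (Fin m)) (j : Fin m) :
    g.inner ((extChartAt (𝓡 m) p).symm y) (ofCoord p _ v) (ofCoord p _ (EuclideanSpace.single j 1))
      = ∑ i, v i * metricMatrix g p y i j := by
  rw [ofCoord_eq_sum ((extChartAt (𝓡 m) p).map_target hy) v, g.symm]
  simp only [map_sum, map_smul, smul_eq_mul]
  exact Finset.sum_congr rfl fun i _ => congrArg (v i * ·) (g.symm _ _ _)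

theorem inner_ofCoord (g : Metric m M) {p : M} {y : EuclideanSpace ℝ (Fin m)}
    (hy : y ∈ (extChartAt (𝓡 m) p).target) (v w : EuclideanSpace ℝ (Fin m)) :
    g.inner ((extChartAt (𝓡 m) p).symm y) (ofCoord p _ v) (ofCoord p _ w)
      = ∑ j, w j * ∑ i, v i * metricMatrix g p y i j := by
  rw [ofCoord_eq_sum ((extChartAt (𝓡 m) p).map_target hy) w]
  simp only [map_sum, map_smul, inner_ofCoord_single g hy, smul_eq_mul]

theorem metricMatrix_symm (g : Metric m M) (p : M) (y : EuclideanSpace ℝ (Fin m)) (i j : Fin m) :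
    metricMatrix g p y i j = metricMatrix g p y j i := g.symm _ _ _

/-- A vector in the kernel of the matrix would have g-length zero, contradicting positivity. -/
theorem det_metricMatrix_ne_zero (g : Metric m M) {p : M} {y : EuclideanSpace ℝ (Fin m)}
    (hy : y ∈ (extChartAt (𝓡 m) p).target) : (metricMatrix g p y).det ≠ 0 := by
  intro h0
  obtain ⟨v, hv, hv0⟩ := Matrix.exists_vecMul_eq_zero_iff.mpr h0
  have hx := (extChartAt (𝓡 m) p).map_target hy
  have hw : ofCoord p ((extChartAt (𝓡 m) p).symm y) (WithLp.toLp 2 v) = 0 := by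
    by_contra hne
    refine (g.pos _ _ hne).ne' ?_
    rw [inner_ofCoord g hy]
    refine Finset.sum_eq_zero fun j _ => ?_
    have := congrFun hv0 j
    simp only [Matrix.vecMul, dotProduct, Pi.zero_apply] at this
    simp [this]
  have h1 := toCoord_ofCoord hx (WithLp.toLp 2 v)
  rw [hw, toCoord_eq_continuousLinearMapAt hx, map_zero] at h1
  apply hv
  ext i
  exact (congrArg (fun z : EuclideanSpace ℝ (Fin m) => z i) h1).symm

/-- Cramer's rule: the entries of the adjugate are determinants of the matrix with one row made
constant, so smoothness of determinants suffices. -/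
theorem contDiffOn_invMetricMatrix (g : Metric m M) (p : M) (i j : Fin m) :
    ContDiffOn ℝ ∞ (fun y => invMetricMatrix g p y i j) (extChartAt (𝓡 m) p).target := by
  have hdet {A : EuclideanSpace ℝ (Fin m) → Matrix (Fin m) (Fin m) ℝ}
      (hA : ∀ i j, ContDiffOn ℝ ∞ (fun y => A y i j) (extChartAt (𝓡 m) p).target) :
      ContDiffOn ℝ ∞ (fun y => (A y).det) (extChartAt (𝓡 m) p).target := by
    simp only [Matrix.det_apply, Units.smul_def, zsmul_eq_mul]
    exact ContDiffOn.sum fun σ _ => contDiffOn_const.mul (contDiffOn_prod fun k _ => hA _ _)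
  have hg := contDiffOn_metricMatrix g p
  simp only [invMetricMatrix, Matrix.inv_def, Ring.inverse_eq_inv', Matrix.smul_apply, smul_eq_mul,
    Matrix.adjugate_apply]
  refine ((hdet hg).inv fun y hy => det_metricMatrix_ne_zero g hy).mul (hdet fun k l => ?_)
  by_cases hk : k = j
  · subst hk
    simpa using contDiffOn_const
  · simpa [Matrix.updateRow_ne hk] using hg k l

theorem inv_mul_metricMatrix (g : Metric m M) {p : M} {y : EuclideanSpace ℝ (Fin m)}
    (hy : y ∈ (extChartAt (𝓡 m) p).target) (i k : Fin m) :
    ∑ j, invMetricMatrix g p y i j * metricMatrix g p y j k = if i = k then 1 else 0 := by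
  rw [← Matrix.mul_apply, invMetricMatrix,
    Matrix.nonsing_inv_mul _ (det_metricMatrix_ne_zero g hy).isUnit, Matrix.one_apply]

theorem invMetricMatrix_symm (g : Metric m M) (p : M) (y : EuclideanSpace ℝ (Fin m))
    (i j : Fin m) : invMetricMatrix g p y i j = invMetricMatrix g p y j i := by
  have h : (metricMatrix g p y).transpose = metricMatrix g p y := by
    ext i j
    exact metricMatrix_symm g p y j i
  exact (congrFun (congrFun (((metricMatrix g p y).transpose_nonsing_inv).trans
    (congrArg (·⁻¹) h)) i) j).symm

end TangentCoordinates

/-! ### The open set on which φ is read in charts -/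

section ChartDomain

variable {m n : ℕ} {M N : Type*}
  [TopologicalSpace M] [ChartedSpace (EuclideanSpace ℝ (Fin m)) M]
  [TopologicalSpace N] [ChartedSpace (EuclideanSpace ℝ (Fin n)) N]

/-- The part of the chart domain around `p` that `φ` maps to the chart domain around `φ p`. -/
def chartDomain (φ : M → N) (p : M) : Set (EuclideanSpace ℝ (Fin m)) :=
  (extChartAt (𝓡 m) p).target ∩
    (extChartAt (𝓡 m) p).symm ⁻¹' (φ ⁻¹' (extChartAt (𝓡 n) (φ p)).source)

theorem isOpen_chartDomain {φ : M → N} (hφ : Continuous φ) (p : M) :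
    IsOpen (chartDomain (m := m) (n := n) φ p) :=
  (continuousOn_extChartAt_symm p).isOpen_inter_preimage (isOpen_extChartAt_target p)
    ((isOpen_extChartAt_source (φ p)).preimage hφ)

theorem extChartAt_mem_chartDomain (φ : M → N) (p : M) :
    extChartAt (𝓡 m) p p ∈ chartDomain (m := m) (n := n) φ p :=
  ⟨mem_extChartAt_target p, by simp⟩

end ChartDomain

/-! ### The gradient, φ and dφ(grad f) in charts -/

section CoordinateExpressions

variable {m n : ℕ} {M N : Type*}
  [TopologicalSpace M] [ChartedSpace (EuclideanSpace ℝ (Fin m)) M] [IsManifold (𝓡 m) ∞ M]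
  [TopologicalSpace N] [ChartedSpace (EuclideanSpace ℝ (Fin n)) N] [IsManifold (𝓡 n) ∞ N]

theorem fderiv_apply_eq_sum {V : Type*} [NormedAddCommGroup V] [NormedSpace ℝ V]
    (f : EuclideanSpace ℝ (Fin m) → V) (y w : EuclideanSpace ℝ (Fin m)) :
    fderiv ℝ f y w = ∑ i, w i • partialDeriv i f y := by
  simp only [partialDeriv, ← map_smul, ← map_sum]
  congr 1
  ext j
  simp [Pi.single_apply]

/-- The components `∑ₗ gᵏˡ ∂ₗ f` of the gradient in the chart around `p`, for a function `f` given
in this chart. -/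
def gradCoord (g : Metric m M) (p : M) (f : EuclideanSpace ℝ (Fin m) → ℝ)
    (y : EuclideanSpace ℝ (Fin m)) : EuclideanSpace ℝ (Fin m) :=
  WithLp.toLp 2 fun k => ∑ l, invMetricMatrix g p y k l * partialDeriv l f y

theorem mdifferentiableAt_extChartAt_symm_of_mem {p : M} {y : EuclideanSpace ℝ (Fin m)}
    (hy : y ∈ (extChartAt (𝓡 m) p).target) :
    MDifferentiableAt 𝓘(ℝ, EuclideanSpace ℝ (Fin m)) (𝓡 m) (extChartAt (𝓡 m) p).symm y := by
  have := mdifferentiableWithinAt_extChartAt_symm hy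
  rwa [ModelWithCorners.range_eq_univ, mdifferentiableWithinAt_univ] at this

theorem mfderiv_ofCoord {f : M → ℝ} (hf : MDifferentiable (𝓡 m) 𝓘(ℝ, ℝ) f) {p : M}
    {y : EuclideanSpace ℝ (Fin m)} (hy : y ∈ (extChartAt (𝓡 m) p).target)
    (w : EuclideanSpace ℝ (Fin m)) :
    mfderiv (𝓡 m) 𝓘(ℝ, ℝ) f ((extChartAt (𝓡 m) p).symm y) (ofCoord p _ w)
      = fderiv ℝ (f ∘ (extChartAt (𝓡 m) p).symm) y w := by
  rw [ofCoord_eq_mfderiv hy, ← mfderiv_eq_fderiv,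
    mfderiv_comp y (hf _) (mdifferentiableAt_extChartAt_symm_of_mem hy)]
  rfl

/-- Nondegeneracy reduces this to pairing with an arbitrary vector, where the contraction gⁱˡ gᵢⱼ =
δˡⱼ leaves ∂ⱼf. -/
theorem grad_eq_ofCoord (g : Metric m M) {f : M → ℝ} (hf : MDifferentiable (𝓡 m) 𝓘(ℝ, ℝ) f)
    {p : M} {y : EuclideanSpace ℝ (Fin m)} (hy : y ∈ (extChartAt (𝓡 m) p).target) :
    grad g f ((extChartAt (𝓡 m) p).symm y)
      = ofCoord p _ (gradCoord g p (f ∘ (extChartAt (𝓡 m) p).symm) y) := by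
  refine (LinearEquiv.symm_apply_eq _).2 ?_
  refine LinearMap.ext fun v => ?_
  refine Eq.trans ?_ (LinearMap.BilinForm.toDual_def (bilinAt_nondegenerate g _)).symm
  obtain ⟨w, rfl⟩ : ∃ w, ofCoord p _ w = v :=
    ⟨_, ofCoord_toCoord ((extChartAt (𝓡 m) p).map_target hy) v⟩
  refine (mfderiv_ofCoord hf hy w).trans
    (Eq.trans ?_ (inner_ofCoord g hy _ w).symm)
  rw [fderiv_apply_eq_sum]
  refine Finset.sum_congr rfl fun j _ => ?_
  rw [smul_eq_mul]
  congr 1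
  simp only [gradCoord, Finset.sum_mul]
  rw [Finset.sum_comm]
  have h (l : Fin m) : ∑ i, invMetricMatrix g p y i l *
      partialDeriv l (f ∘ (extChartAt (𝓡 m) p).symm) y * metricMatrix g p y i j
      = (if l = j then 1 else 0) * partialDeriv l (f ∘ (extChartAt (𝓡 m) p).symm) y := by
    rw [← inv_mul_metricMatrix g hy, Finset.sum_mul]
    refine Finset.sum_congr rfl fun i _ => ?_
    rw [invMetricMatrix_symm g p y l i]
    ring
  simp only [h, ite_mul, one_mul, zero_mul, Finset.sum_ite_eq', Finset.mem_univ, if_true]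

theorem contDiffOn_mapCoord {φ : M → N} (hφ : ContMDiff (𝓡 m) (𝓡 n) ∞ φ) (p : M) :
    ContDiffOn ℝ ∞ (mapCoord (m := m) (n := n) φ p) (chartDomain (m := m) (n := n) φ p) := by
  rw [← contMDiffOn_iff_contDiffOn]
  refine (contMDiffOn_extChartAt (x := φ p)).comp
    (t := (chartAt (EuclideanSpace ℝ (Fin n)) (φ p)).source) (hφ.comp_contMDiffOn
    ((contMDiffOn_extChartAt_symm p).mono Set.inter_subset_left)) fun y hy => ?_
  have := hy.2
  rwa [extChartAt_source] at this

theorem toCoord_mfderiv_ofCoord {φ : M → N} (hφ : MDifferentiable (𝓡 m) (𝓡 n) φ) {p : M}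
    {y : EuclideanSpace ℝ (Fin m)} (hy : y ∈ chartDomain (m := m) (n := n) φ p)
    (w : EuclideanSpace ℝ (Fin m)) :
    toCoord (φ p) (φ ((extChartAt (𝓡 m) p).symm y))
      (mfderiv (𝓡 m) (𝓡 n) φ ((extChartAt (𝓡 m) p).symm y) (ofCoord p _ w))
      = fderiv ℝ (mapCoord (n := n) φ p) y w := by
  have hs := hy.2
  have hs' : φ ((extChartAt (𝓡 m) p).symm y) ∈ (chartAt (EuclideanSpace ℝ (Fin n)) (φ p)).source := by
    rw [extChartAt_source] at hs
    exact hs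
  have hd := mdifferentiableAt_extChartAt_symm_of_mem (m := m) hy.1
  rw [toCoord_eq_mfderiv hs, ofCoord_eq_mfderiv hy.1, ← mfderiv_eq_fderiv]
  have h1 := mfderiv_comp y (mdifferentiableAt_extChartAt (I := 𝓡 n) hs')
    ((hφ ((extChartAt (𝓡 m) p).symm y)).comp y hd)
  have h2 := mfderiv_comp y (hφ ((extChartAt (𝓡 m) p).symm y)) hd
  rw [h2] at h1
  exact (congrArg (fun L => L w) h1).symm

/-- The formula holds on the whole chart domain, not only at p, so it supplies the smoothness needed
to differentiate the field twice. -/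
theorem fieldCoord_pushGrad (g : Metric m M) {φ : M → N} (hφ : MDifferentiable (𝓡 m) (𝓡 n) φ)
    {f : M → ℝ} (hf : MDifferentiable (𝓡 m) 𝓘(ℝ, ℝ) f) {p : M} {y : EuclideanSpace ℝ (Fin m)}
    (hy : y ∈ chartDomain (m := m) (n := n) φ p) :
    fieldCoord (pushGrad g φ f) p y
      = ∑ k, gradCoord g p (f ∘ (extChartAt (𝓡 m) p).symm) y k •
        partialDeriv k (mapCoord (n := n) φ p) y := by
  rw [← fderiv_apply_eq_sum, ← toCoord_mfderiv_ofCoord hφ hy, fieldCoord, pushGrad,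
    grad_eq_ofCoord g hf hy.1]

theorem contDiffOn_partialDeriv {V : Type*} [NormedAddCommGroup V] [NormedSpace ℝ V]
    {f : EuclideanSpace ℝ (Fin m) → V} {s : Set (EuclideanSpace ℝ (Fin m))} (hs : IsOpen s)
    (hf : ContDiffOn ℝ ∞ f s) (i : Fin m) : ContDiffOn ℝ ∞ (partialDeriv i f) s :=
  (hf.fderiv_of_isOpen hs (by simp)).clm_apply contDiffOn_const

theorem contDiffOn_comp_extChartAt_symm {f : M → ℝ} (hf : ContMDiff (𝓡 m) 𝓘(ℝ, ℝ) ∞ f) (p : M) :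
    ContDiffOn ℝ ∞ (f ∘ (extChartAt (𝓡 m) p).symm) (extChartAt (𝓡 m) p).target := by
  rw [← contMDiffOn_iff_contDiffOn]
  exact hf.comp_contMDiffOn (contMDiffOn_extChartAt_symm p)

theorem contDiffOn_fieldCoord_pushGrad (g : Metric m M) {φ : M → N}
    (hφ : ContMDiff (𝓡 m) (𝓡 n) ∞ φ) {f : M → ℝ} (hf : ContMDiff (𝓡 m) 𝓘(ℝ, ℝ) ∞ f) (p : M) :
    ContDiffOn ℝ ∞ (fieldCoord (n := n) (pushGrad g φ f) p) (chartDomain (m := m) (n := n) φ p) := by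
  refine ContDiffOn.congr ?_ fun y hy => fieldCoord_pushGrad (n := n) g
    (hφ.mdifferentiable (by simp)) (hf.mdifferentiable (by simp)) hy
  have hG (k : Fin m) : ContDiffOn ℝ ∞
      (fun y => gradCoord g p (f ∘ (extChartAt (𝓡 m) p).symm) y k) (extChartAt (𝓡 m) p).target := by
    simp only [gradCoord]
    exact ContDiffOn.sum fun l _ => (contDiffOn_invMetricMatrix g p k l).mul
      (contDiffOn_partialDeriv (isOpen_extChartAt_target p)
        (contDiffOn_comp_extChartAt_symm hf p) l)
  exact ContDiffOn.sum fun k _ => ((hG k).mono Set.inter_subset_left).smul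
    (contDiffOn_partialDeriv (isOpen_chartDomain hφ.continuous p) (contDiffOn_mapCoord hφ p) k)

end CoordinateExpressions

theorem contMDiff_log_comp {m : ℕ} {M : Type*} [TopologicalSpace M]
    [ChartedSpace (EuclideanSpace ℝ (Fin m)) M] {F : M → ℝ} (hF : ContMDiff (𝓡 m) 𝓘(ℝ, ℝ) ∞ F)
    (hpos : ∀ x, 0 < F x) : ContMDiff (𝓡 m) 𝓘(ℝ, ℝ) ∞ (Real.log ∘ F) := fun x =>
  (Real.contDiffAt_log.2 (hpos x).ne').contMDiffAt.comp x (hF x)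

/-! ### Inverse metric, Christoffel symbols and traces under conformal change -/

section ConformalChange

variable {m : ℕ} {M : Type*}
  [TopologicalSpace M] [ChartedSpace (EuclideanSpace ℝ (Fin m)) M] [IsManifold (𝓡 m) ∞ M]

variable (g : Metric m M) {F : M → ℝ} (hF : ContMDiff (𝓡 m) 𝓘(ℝ, ℝ) ∞ F) (hpos : ∀ x, 0 < F x)

/-- The function `ln F` in the chart around `p`. -/
abbrev logCoord (F : M → ℝ) (p : M) : EuclideanSpace ℝ (Fin m) → ℝ :=
  (Real.log ∘ F) ∘ (extChartAt (𝓡 m) p).symm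

theorem metricMatrix_conformalChange (p : M) (y : EuclideanSpace ℝ (Fin m)) (i j : Fin m) :
    metricMatrix (conformalChange g F hF hpos) p y i j
      = Real.exp (-2 * logCoord F p y) * metricMatrix g p y i j := by
  -- Writing F⁻² as e^{-2 ln F} makes its derivatives multiples of itself.
  have h : Real.exp (-2 * logCoord F p y) = (F ((extChartAt (𝓡 m) p).symm y) ^ 2)⁻¹ := by
    have := hpos ((extChartAt (𝓡 m) p).symm y)
    rw [neg_mul, Real.exp_neg, ← Real.exp_log (pow_pos this 2), Real.log_pow]
    simp [logCoord]
  rw [h]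
  rfl

theorem invMetricMatrix_conformalChange {p : M} {y : EuclideanSpace ℝ (Fin m)}
    (hy : y ∈ (extChartAt (𝓡 m) p).target) (i j : Fin m) :
    invMetricMatrix (conformalChange g F hF hpos) p y i j
      = Real.exp (2 * logCoord F p y) * invMetricMatrix g p y i j := by
  have h : (metricMatrix (conformalChange g F hF hpos) p y)⁻¹
      = Real.exp (2 * logCoord F p y) • invMetricMatrix g p y := by
    refine Matrix.inv_eq_left_inv ?_
    ext i k
    simp only [Matrix.mul_apply, Matrix.smul_apply, smul_eq_mul, Matrix.one_apply,
      metricMatrix_conformalChange, ← inv_mul_metricMatrix g hy]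
    refine Finset.sum_congr rfl fun j _ => ?_
    have : Real.exp (2 * logCoord F p y) * Real.exp (-2 * logCoord F p y) = 1 := by
      rw [← Real.exp_add]
      simp
    linear_combination (invMetricMatrix g p y i j * metricMatrix g p y j k) * this
  exact congrFun (congrFun h i) j

theorem differentiableAt_logCoord (hF : ContMDiff (𝓡 m) 𝓘(ℝ, ℝ) ∞ F) (hpos : ∀ x, 0 < F x)
    {p : M} {y : EuclideanSpace ℝ (Fin m)} (hy : y ∈ (extChartAt (𝓡 m) p).target) :
    DifferentiableAt ℝ (logCoord F p) y :=
  ((contDiffOn_comp_extChartAt_symm (contMDiff_log_comp hF hpos) p).differentiableOn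
    (by simp)).differentiableAt ((isOpen_extChartAt_target p).mem_nhds hy)

theorem partialDeriv_metricMatrix_conformalChange {p : M} {y : EuclideanSpace ℝ (Fin m)}
    (hy : y ∈ (extChartAt (𝓡 m) p).target) (i j k : Fin m) :
    partialDeriv k (fun z => metricMatrix (conformalChange g F hF hpos) p z i j) y
      = Real.exp (-2 * logCoord F p y) * (partialDeriv k (fun z => metricMatrix g p z i j) y
        - 2 * partialDeriv k (logCoord F p) y * metricMatrix g p y i j) := by
  have hg : DifferentiableAt ℝ (fun z => metricMatrix g p z i j) y :=
    ((contDiffOn_metricMatrix g p i j).differentiableOn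
      (by simp)).differentiableAt ((isOpen_extChartAt_target p).mem_nhds hy)
  have hf := differentiableAt_logCoord hF hpos hy
  simp only [metricMatrix_conformalChange, partialDeriv]
  have h := (((hf.hasFDerivAt.const_mul (-2 : ℝ)).exp).mul hg.hasFDerivAt).fderiv
  erw [h]
  simp only [FunLike.coe_add, FunLike.coe_smul, Pi.add_apply, Pi.smul_apply, smul_eq_mul]
  ring

/-- Differentiating e^{-2f} gᵢⱼ adds -2 ∂f g to each metric derivative, and the exponential cancels
against that of the inverse metric. -/
theorem christoffel_conformalChange {p : M} {y : EuclideanSpace ℝ (Fin m)}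
    (hy : y ∈ (extChartAt (𝓡 m) p).target) (i j k : Fin m) :
    christoffel (conformalChange g F hF hpos) p i j k y
      = christoffel g p i j k y
        - (partialDeriv i (logCoord F p) y * (if k = j then 1 else 0)
          + partialDeriv j (logCoord F p) y * (if k = i then 1 else 0)
          - metricMatrix g p y i j * gradCoord g p (logCoord F p) y k) := by
  have hexp : Real.exp (2 * logCoord F p y) * Real.exp (-2 * logCoord F p y) = 1 := by
    rw [← Real.exp_add]
    simp
  -- Expanding both Kronecker deltas as contractions over l lets the identity be checked summand by
  -- summand.
  rw [← inv_mul_metricMatrix g hy, ← inv_mul_metricMatrix g hy]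
  simp only [christoffel, gradCoord, invMetricMatrix_conformalChange g hF hpos hy,
    partialDeriv_metricMatrix_conformalChange g hF hpos hy, Finset.mul_sum,
    ← Finset.sum_add_distrib, ← Finset.sum_sub_distrib]
  refine Finset.sum_congr rfl fun l _ => ?_
  rw [metricMatrix_symm g p y l j, metricMatrix_symm g p y l i]
  linear_combination (1 / 2 * invMetricMatrix g p y k l *
    (partialDeriv i (fun z => metricMatrix g p z j l) y
        - 2 * partialDeriv i (logCoord F p) y * metricMatrix g p y j l
      + (partialDeriv j (fun z => metricMatrix g p z i l) y
        - 2 * partialDeriv j (logCoord F p) y * metricMatrix g p y i l)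
      - (partialDeriv l (fun z => metricMatrix g p z i j) y
        - 2 * partialDeriv l (logCoord F p) y * metricMatrix g p y i j))) * hexp

/-- The two delta terms each trace to grad f and the metric term to m grad f, so the correction is
-(1 + 1 - m) grad f. -/
theorem sum_invMetricMatrix_mul_christoffel_conformalChange {p : M}
    {y : EuclideanSpace ℝ (Fin m)} (hy : y ∈ (extChartAt (𝓡 m) p).target) (k : Fin m) :
    ∑ i, ∑ j, invMetricMatrix g p y i j * christoffel (conformalChange g F hF hpos) p i j k y
      = ∑ i, ∑ j, invMetricMatrix g p y i j * christoffel g p i j k y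
        + ((m : ℝ) - 2) * gradCoord g p (logCoord F p) y k := by
  have h1 : ∑ i, ∑ j, invMetricMatrix g p y i j *
      (partialDeriv i (logCoord F p) y * (if k = j then 1 else 0))
      = gradCoord g p (logCoord F p) y k := by
    simp [gradCoord, invMetricMatrix_symm g p y k]
  have h2 : ∑ i, ∑ j, invMetricMatrix g p y i j *
      (partialDeriv j (logCoord F p) y * (if k = i then 1 else 0))
      = gradCoord g p (logCoord F p) y k := by
    rw [Finset.sum_comm]
    simp [gradCoord]
  have h3 : ∑ i, ∑ j, invMetricMatrix g p y i j *
      (metricMatrix g p y i j * gradCoord g p (logCoord F p) y k)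
      = m * gradCoord g p (logCoord F p) y k := by
    have (i : Fin m) : ∑ j, invMetricMatrix g p y i j * metricMatrix g p y i j = 1 := by
      simpa [metricMatrix_symm g p y i] using inv_mul_metricMatrix g hy i i
    simp only [← mul_assoc, ← Finset.sum_mul, this]
    simp
  simp only [christoffel_conformalChange g hF hpos hy, mul_sub, mul_add, Finset.sum_sub_distrib,
    Finset.sum_add_distrib, h1, h2, h3]
  ring

/-- The trace of a second covariant derivative with respect to a conformal metric. -/
theorem sum_invMetricMatrix_smul_conformalChange {p : M} {y : EuclideanSpace ℝ (Fin m)}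
    (hy : y ∈ (extChartAt (𝓡 m) p).target) {V : Type*} [AddCommGroup V] [Module ℝ V]
    (A : Fin m → Fin m → V) (B : Fin m → V) :
    ∑ i, ∑ j, invMetricMatrix (conformalChange g F hF hpos) p y i j •
        (A i j - ∑ k, christoffel (conformalChange g F hF hpos) p i j k y • B k)
      = Real.exp (2 * logCoord F p y) •
        (∑ i, ∑ j, invMetricMatrix g p y i j • (A i j - ∑ k, christoffel g p i j k y • B k)
          - ((m : ℝ) - 2) • ∑ k, gradCoord g p (logCoord F p) y k • B k) := by
  have key (Γ : Fin m → Fin m → Fin m → ℝ) :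
      ∑ i, ∑ j, invMetricMatrix g p y i j • ∑ k, Γ i j k • B k
        = ∑ k, (∑ i, ∑ j, invMetricMatrix g p y i j * Γ i j k) • B k := by
    simp only [Finset.smul_sum, Finset.sum_smul, smul_smul]
    rw [Finset.sum_comm_cycle]
  simp only [invMetricMatrix_conformalChange g hF hpos hy, mul_smul, ← Finset.smul_sum]
  congr 1
  simp only [smul_sub, Finset.sum_sub_distrib]
  rw [key, key]
  simp only [sum_invMetricMatrix_mul_christoffel_conformalChange g hF hpos hy, add_smul,
    Finset.sum_add_distrib, mul_smul, ← Finset.smul_sum]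
  abel

end ConformalChange

open Filter Topology

/-! ### Leibniz rules for the pull-back connection -/

section Leibniz

variable {m n : ℕ} {M N : Type*}
  [TopologicalSpace M] [ChartedSpace (EuclideanSpace ℝ (Fin m)) M]
  [TopologicalSpace N] [ChartedSpace (EuclideanSpace ℝ (Fin n)) N] [IsManifold (𝓡 n) ∞ N]

theorem partialDeriv_add {V : Type*} [NormedAddCommGroup V] [NormedSpace ℝ V] (i : Fin m)
    {X Y : EuclideanSpace ℝ (Fin m) → V} {y : EuclideanSpace ℝ (Fin m)}
    (hX : DifferentiableAt ℝ X y) (hY : DifferentiableAt ℝ Y y) :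
    partialDeriv i (fun z => X z + Y z) y = partialDeriv i X y + partialDeriv i Y y := by
  simp only [partialDeriv, fderiv_fun_add hX hY, FunLike.coe_add, Pi.add_apply]

theorem partialDeriv_smul {V : Type*} [NormedAddCommGroup V] [NormedSpace ℝ V] (i : Fin m)
    {a : EuclideanSpace ℝ (Fin m) → ℝ} {X : EuclideanSpace ℝ (Fin m) → V}
    {y : EuclideanSpace ℝ (Fin m)} (ha : DifferentiableAt ℝ a y) (hX : DifferentiableAt ℝ X y) :
    partialDeriv i (fun z => a z • X z) y
      = partialDeriv i a y • X y + a y • partialDeriv i X y := by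
  simp only [partialDeriv, fderiv_fun_smul ha hX]
  simp [add_comm]

theorem covDerivCoord_add (h : Metric n N) (φ : M → N) (p : M) (i : Fin m)
    {X Y : EuclideanSpace ℝ (Fin m) → EuclideanSpace ℝ (Fin n)} {y : EuclideanSpace ℝ (Fin m)}
    (hX : DifferentiableAt ℝ X y) (hY : DifferentiableAt ℝ Y y) :
    covDerivCoord h φ p i (fun z => X z + Y z) y
      = covDerivCoord h φ p i X y + covDerivCoord h φ p i Y y := by
  simp only [covDerivCoord, partialDeriv_add i hX hY]
  ext c
  simp only [PiLp.add_apply, mul_add, Finset.sum_add_distrib]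
  ring

theorem covDerivCoord_smul (h : Metric n N) (φ : M → N) (p : M) (i : Fin m)
    {a : EuclideanSpace ℝ (Fin m) → ℝ}
    {X : EuclideanSpace ℝ (Fin m) → EuclideanSpace ℝ (Fin n)} {y : EuclideanSpace ℝ (Fin m)}
    (ha : DifferentiableAt ℝ a y) (hX : DifferentiableAt ℝ X y) :
    covDerivCoord h φ p i (fun z => a z • X z) y
      = partialDeriv i a y • X y + a y • covDerivCoord h φ p i X y := by
  simp only [covDerivCoord, partialDeriv_smul i ha hX]
  ext c
  simp only [PiLp.add_apply, PiLp.smul_apply, smul_eq_mul, mul_add, Finset.mul_sum, add_assoc]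
  congr 2
  exact Finset.sum_congr rfl fun _ _ => Finset.sum_congr rfl fun _ _ => by ring

theorem covDerivCoord_congr (h : Metric n N) (φ : M → N) (p : M) (i : Fin m)
    {X Y : EuclideanSpace ℝ (Fin m) → EuclideanSpace ℝ (Fin n)} {y : EuclideanSpace ℝ (Fin m)}
    (hXY : X =ᶠ[𝓝 y] Y) : covDerivCoord h φ p i X y = covDerivCoord h φ p i Y y := by
  simp only [covDerivCoord, partialDeriv, hXY.fderiv_eq, hXY.eq_of_nhds]

theorem partialDeriv_const_mul_exp (i : Fin m) (c : ℝ) {f : EuclideanSpace ℝ (Fin m) → ℝ}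
    {y : EuclideanSpace ℝ (Fin m)} (hf : DifferentiableAt ℝ f y) :
    partialDeriv i (fun z => c * Real.exp (2 * f z)) y
      = (c * Real.exp (2 * f y)) * (2 * partialDeriv i f y) := by
  have h := ((hf.hasFDerivAt.const_mul (2 : ℝ)).exp.const_mul c).fderiv
  simp only [partialDeriv, h]
  simp only [FunLike.coe_smul, Pi.smul_apply, smul_eq_mul]
  ring

/-- The result is again c e^{2f} times a field, so the rule can be iterated. -/
theorem covDerivCoord_exp_smul (h : Metric n N) {φ : M → N}
    (hφ : ContMDiff (𝓡 m) (𝓡 n) ∞ φ) {p : M} {f : EuclideanSpace ℝ (Fin m) → ℝ}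
    (hf : ContDiffOn ℝ ∞ f (chartDomain (m := m) (n := n) φ p))
    {X : EuclideanSpace ℝ (Fin m) → EuclideanSpace ℝ (Fin n)}
    (hX : ContDiffOn ℝ ∞ X (chartDomain (m := m) (n := n) φ p)) (c : ℝ)
    {y : EuclideanSpace ℝ (Fin m)} (hy : y ∈ chartDomain (m := m) (n := n) φ p) (j : Fin m) :
    covDerivCoord h φ p j (fun z => (c * Real.exp (2 * f z)) • X z) y
      = (c * Real.exp (2 * f y)) • ((2 * partialDeriv j f y) • X y + covDerivCoord h φ p j X y) := by
  have hU := (isOpen_chartDomain (m := m) (n := n) hφ.continuous p).mem_nhds hy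
  have hf' := (hf.differentiableOn (by simp)).differentiableAt hU
  rw [covDerivCoord_smul h φ p j ((hf'.const_mul 2).exp.const_mul c)
    ((hX.differentiableOn (by simp)).differentiableAt hU), partialDeriv_const_mul_exp j c hf',
    smul_add, smul_smul]

end Leibniz

/-! ### Second covariant derivatives of c e^{2f} X -/

section CovariantDerivative

variable {m n : ℕ} {M N : Type*}
  [TopologicalSpace M] [ChartedSpace (EuclideanSpace ℝ (Fin m)) M] [IsManifold (𝓡 m) ∞ M]
  [TopologicalSpace N] [ChartedSpace (EuclideanSpace ℝ (Fin n)) N] [IsManifold (𝓡 n) ∞ N]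

theorem contDiffOn_christoffel (h : Metric n N) (q : N) (a b c : Fin n) :
    ContDiffOn ℝ ∞ (christoffel h q a b c) (extChartAt (𝓡 n) q).target := by
  have hd (i j k : Fin n) := contDiffOn_partialDeriv (isOpen_extChartAt_target q)
    (contDiffOn_metricMatrix h q j k) i
  exact contDiffOn_const.mul (ContDiffOn.sum fun l _ => (contDiffOn_invMetricMatrix h q c l).mul
    (((hd a b l).add (hd b a l)).sub (hd l a b)))

theorem contDiffOn_covDerivCoord (h : Metric n N) {φ : M → N} (hφ : ContMDiff (𝓡 m) (𝓡 n) ∞ φ)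
    (p : M) (i : Fin m) {X : EuclideanSpace ℝ (Fin m) → EuclideanSpace ℝ (Fin n)}
    (hX : ContDiffOn ℝ ∞ X (chartDomain (m := m) (n := n) φ p)) :
    ContDiffOn ℝ ∞ (covDerivCoord h φ p i X) (chartDomain (m := m) (n := n) φ p) := by
  have hU := isOpen_chartDomain (m := m) (n := n) hφ.continuous p
  have hm := contDiffOn_mapCoord hφ p
  have hmaps : Set.MapsTo (mapCoord φ p) (chartDomain (m := m) (n := n) φ p)
      (extChartAt (𝓡 n) (φ p)).target := fun y hy => (extChartAt (𝓡 n) (φ p)).map_source hy.2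
  refine (contDiffOn_partialDeriv hU hX i).add ?_
  rw [contDiffOn_piLp]
  intro c
  change ContDiffOn ℝ ∞ (fun y => ∑ a, ∑ b, christoffel h (φ p) a b c (mapCoord φ p y) *
    partialDeriv i (mapCoord φ p) y a * X y b) _
  exact ContDiffOn.sum fun a _ => ContDiffOn.sum fun b _ =>
    (((contDiffOn_christoffel h (φ p) a b c).comp hm hmaps).mul
      ((contDiffOn_piLp 2).1 (contDiffOn_partialDeriv hU hm i) a)).mul
      ((contDiffOn_piLp 2).1 hX b)

theorem covDerivCoord_covDerivCoord_exp_smul (h : Metric n N) {φ : M → N}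
    (hφ : ContMDiff (𝓡 m) (𝓡 n) ∞ φ) {p : M} {f : EuclideanSpace ℝ (Fin m) → ℝ}
    (hf : ContDiffOn ℝ ∞ f (chartDomain (m := m) (n := n) φ p))
    {X : EuclideanSpace ℝ (Fin m) → EuclideanSpace ℝ (Fin n)}
    (hX : ContDiffOn ℝ ∞ X (chartDomain (m := m) (n := n) φ p)) (c : ℝ)
    {y : EuclideanSpace ℝ (Fin m)} (hy : y ∈ chartDomain (m := m) (n := n) φ p) (i j : Fin m) :
    covDerivCoord h φ p i
        (covDerivCoord h φ p j (fun z => (c * Real.exp (2 * f z)) • X z)) y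
      = (c * Real.exp (2 * f y)) • (covDerivCoord h φ p i (covDerivCoord h φ p j X) y
        + (2 * partialDeriv i f y) • covDerivCoord h φ p j X y
        + (2 * partialDeriv j f y) • covDerivCoord h φ p i X y
        + (4 * (partialDeriv i f y * partialDeriv j f y)
          + 2 * partialDeriv i (partialDeriv j f) y) • X y) := by
  have hUo := isOpen_chartDomain (m := m) (n := n) hφ.continuous p
  have hU := hUo.mem_nhds hy
  have hdf := (contDiffOn_partialDeriv hUo hf j)
  have hcX := contDiffOn_covDerivCoord h hφ p j hX
  have h2dX : ContDiffOn ℝ ∞ (fun z => (2 * partialDeriv j f z) • X z)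
      (chartDomain (m := m) (n := n) φ p) := (contDiffOn_const.mul hdf).smul hX
  have hXd := (hX.differentiableOn (by simp)).differentiableAt hU
  have hdfd := ((hdf.differentiableOn (by simp)).differentiableAt hU).const_mul 2
  -- The first-derivative formula holds near y, so it may be differentiated once more.
  rw [covDerivCoord_congr h φ p i (eventually_of_mem hU fun z hz =>
      covDerivCoord_exp_smul h hφ hf hX c hz j),
    covDerivCoord_exp_smul h hφ hf (h2dX.add hcX) c hy i,
    covDerivCoord_add h φ p i
      ((h2dX.differentiableOn (by simp)).differentiableAt hU)
      ((hcX.differentiableOn (by simp)).differentiableAt hU),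
    covDerivCoord_smul h φ p i hdfd hXd]
  have h2 : partialDeriv i (fun z => 2 * partialDeriv j f z) y
      = 2 * partialDeriv i (partialDeriv j f) y :=
    congrArg (fun L => L (EuclideanSpace.single i 1))
      (fderiv_const_mul ((hdf.differentiableOn (by simp)).differentiableAt hU) 2)
  rw [h2]
  module

end CovariantDerivative

open Filter Topology

theorem sum_smul_smul_add {ι V : Type*} [Fintype ι] [AddCommGroup V] [Module ℝ V] (v b : ι → ℝ)
    (B : ι → V) (X : V) (r : ℝ) : ∑ k, v k • r • ((2 * b k) • X + B k)
      = r • ((2 * ∑ k, v k * b k) • X + ∑ k, v k • B k) := by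
  simp only [Finset.mul_sum, Finset.sum_smul, ← Finset.sum_add_distrib, Finset.smul_sum]
  exact Finset.sum_congr rfl fun k _ => by module

/-- The trace of the second covariant derivative of a product, in terms of the first and second
covariant derivatives `B`, `A` of one factor `X` and the derivatives `b`, `H` of the other. -/
theorem sum_smul_leibniz {m : ℕ} {V : Type*} [AddCommGroup V] [Module ℝ V]
    {G : Fin m → Fin m → ℝ} (hG : ∀ i j, G i j = G j i) (Γ : Fin m → Fin m → Fin m → ℝ)
    (b : Fin m → ℝ) (H : Fin m → Fin m → ℝ) (A : Fin m → Fin m → V) (B : Fin m → V) (X : V)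
    (r : ℝ) :
    ∑ i, ∑ j, G i j • (r • (A i j + (2 * b i) • B j + (2 * b j) • B i
        + (4 * (b i * b j) + 2 * H i j) • X) - ∑ k, Γ i j k • r • ((2 * b k) • X + B k))
      = r • (∑ i, ∑ j, G i j • (A i j - ∑ k, Γ i j k • B k)
        + (4 : ℝ) • ∑ i, (∑ j, G i j * b j) • B i
        + (4 * (∑ i, (∑ j, G i j * b j) * b i)
          + 2 * ∑ i, ∑ j, G i j * (H i j - ∑ k, Γ i j k * b k)) • X) := by
  -- Symmetry of `G` identifies the two cross terms; this is the origin of the coefficient 4 = 2 +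
  -- 2.
  have h1 : ∑ i, ∑ j, (G i j * b i) • B j = ∑ i, (∑ j, G i j * b j) • B i := by
    rw [Finset.sum_comm]
    simp only [Finset.sum_smul, hG]
  have h3 (i j : Fin m) : G i j • (r • (A i j + (2 * b i) • B j + (2 * b j) • B i
        + (4 * (b i * b j) + 2 * H i j) • X) - ∑ k, Γ i j k • r • ((2 * b k) • X + B k))
      = r • (G i j • (A i j - ∑ k, Γ i j k • B k)
        + (2 : ℝ) • (G i j * b i) • B j + (2 : ℝ) • (G i j * b j) • B i
        + (4 : ℝ) • (G i j * b j * b i) • X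
        + (2 : ℝ) • (G i j * (H i j - ∑ k, Γ i j k * b k)) • X) := by
    rw [sum_smul_smul_add]
    module
  simp only [h3, ← Finset.smul_sum, Finset.sum_add_distrib, h1, ← Finset.sum_smul,
    ← Finset.sum_mul]
  module

/-! ### Components of fields along φ -/

section FieldsInCharts

variable {m n : ℕ} {M N : Type*}
  [TopologicalSpace M] [ChartedSpace (EuclideanSpace ℝ (Fin m)) M]
  [TopologicalSpace N] [ChartedSpace (EuclideanSpace ℝ (Fin n)) N]

theorem exp_two_mul_logCoord {F : M → ℝ} (hpos : ∀ x, 0 < F x) (p : M)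
    (y : EuclideanSpace ℝ (Fin m)) :
    Real.exp (2 * logCoord F p y) = F ((extChartAt (𝓡 m) p).symm y) ^ 2 := by
  have := hpos ((extChartAt (𝓡 m) p).symm y)
  rw [← Real.exp_log (pow_pos this 2), Real.log_pow]
  simp [logCoord]

theorem exp_two_mul_logCoord_self {F : M → ℝ} (hpos : ∀ x, 0 < F x) (p : M) :
    Real.exp (2 * logCoord F p (extChartAt (𝓡 m) p p)) = F p ^ 2 := by
  rw [exp_two_mul_logCoord hpos, extChartAt_to_inv p]

variable [IsManifold (𝓡 n) ∞ N]

theorem fieldCoord_self {φ : M → N} (X : FieldAlong n φ) (p : M) :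
    fieldCoord X p (extChartAt (𝓡 m) p p) = toCoord (φ p) (φ p) (X p) := by
  simp only [fieldCoord]
  rw [extChartAt_to_inv p]

theorem ofCoord_fieldCoord_self {φ : M → N} (X : FieldAlong n φ) (p : M) :
    ofCoord (φ p) (φ p) (fieldCoord X p (extChartAt (𝓡 m) p p)) = X p := by
  rw [fieldCoord_self, ofCoord_toCoord (mem_extChartAt_source (φ p))]

theorem fieldCoord_smul {φ : M → N} (a : M → ℝ) (X : FieldAlong n φ) {p : M}
    {y : EuclideanSpace ℝ (Fin m)} (hy : y ∈ chartDomain (m := m) (n := n) φ p) :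
    fieldCoord (φ := φ) (fun x => a x • X x) p y
      = a ((extChartAt (𝓡 m) p).symm y) • fieldCoord X p y :=
  toCoord_smul hy.2 _ _

end FieldsInCharts

/-! ### Tension, curvature trace, rough Laplacian and bitension under conformal change -/

section FieldsAlong

variable {m n : ℕ} {M N : Type*}
  [TopologicalSpace M] [ChartedSpace (EuclideanSpace ℝ (Fin m)) M] [IsManifold (𝓡 m) ∞ M]
  [TopologicalSpace N] [ChartedSpace (EuclideanSpace ℝ (Fin n)) N] [IsManifold (𝓡 n) ∞ N]

theorem toCoord_grad_self (g : Metric m M) {f : M → ℝ} (hf : MDifferentiable (𝓡 m) 𝓘(ℝ, ℝ) f)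
    (p : M) : toCoord p p (grad g f p)
      = gradCoord g p (f ∘ (extChartAt (𝓡 m) p).symm) (extChartAt (𝓡 m) p p) := by
  have h := congrArg (toCoord p _) (grad_eq_ofCoord g hf (mem_extChartAt_target (I := 𝓡 m) p))
  rw [toCoord_ofCoord ((extChartAt (𝓡 m) p).map_target (mem_extChartAt_target p))] at h
  rwa [extChartAt_to_inv p] at h

/-- By definition of the gradient, |grad f|² = df(grad f). -/
theorem inner_grad_grad (g : Metric m M) {f : M → ℝ} (hf : MDifferentiable (𝓡 m) 𝓘(ℝ, ℝ) f)
    (p : M) : g.inner p (grad g f p) (grad g f p)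
      = ∑ k, gradCoord g p (f ∘ (extChartAt (𝓡 m) p).symm) (extChartAt (𝓡 m) p p) k
        * partialDeriv k (f ∘ (extChartAt (𝓡 m) p).symm) (extChartAt (𝓡 m) p p) := by
  have hy := mem_extChartAt_target (I := 𝓡 m) p
  have h1 (x : M) (v : TangentSpace (𝓡 m) x) : g.inner x (grad g f x) v
      = mfderiv (𝓡 m) 𝓘(ℝ, ℝ) f x v :=
    congrArg (fun L : Module.Dual ℝ (TangentSpace (𝓡 m) x) => L v)
      (((bilinAt g x).toDual (bilinAt_nondegenerate g x)).apply_symm_apply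
        (mfderiv (𝓡 m) 𝓘(ℝ, ℝ) f x).toLinearMap)
  have h2 := h1 ((extChartAt (𝓡 m) p).symm (extChartAt (𝓡 m) p p)) (grad g f _)
  have h3 := mfderiv_ofCoord hf hy
    (gradCoord g p (f ∘ (extChartAt (𝓡 m) p).symm) (extChartAt (𝓡 m) p p))
  rw [← grad_eq_ofCoord g hf hy] at h3
  have h4 := h2.trans h3
  rw [extChartAt_to_inv p, fderiv_apply_eq_sum] at h4
  exact h4

variable (g : Metric m M) (h : Metric n N) {φ : M → N} {F : M → ℝ}

/-- The tension field of `φ` with respect to a conformal metric. -/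
theorem tension_conformalChange (hφ : ContMDiff (𝓡 m) (𝓡 n) ∞ φ)
    (hF : ContMDiff (𝓡 m) 𝓘(ℝ, ℝ) ∞ F) (hpos : ∀ x, 0 < F x) (p : M) :
    tension (conformalChange g F hF hpos) h φ p
      = F p ^ 2 • (tension g h φ p - ((m : ℝ) - 2) • pushGrad g φ (Real.log ∘ F) p) := by
  have hq := mem_extChartAt_source (I := 𝓡 n) (φ p)
  have hlog := (contMDiff_log_comp hF hpos).mdifferentiable (by simp)
  rw [← ofCoord_fieldCoord_self (m := m) (n := n) (pushGrad g φ (Real.log ∘ F)) p,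
    fieldCoord_pushGrad g (hφ.mdifferentiable (by simp)) hlog (extChartAt_mem_chartDomain φ p)]
  simp only [tension]
  rw [sum_invMetricMatrix_smul_conformalChange g hF hpos (mem_extChartAt_target p),
    exp_two_mul_logCoord_self hpos, ofCoord_smul hq, ofCoord_sub hq, ofCoord_smul hq]

/-- The metric of M enters only through the trace, giving F², and the expression is tensorial in the
field, so `a` comes out undifferentiated. -/
theorem curvatureTrace_conformalChange_smul (hF : ContMDiff (𝓡 m) 𝓘(ℝ, ℝ) ∞ F)
    (hpos : ∀ x, 0 < F x) (a : M → ℝ) (X : FieldAlong n φ) (p : M) :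
    curvatureTrace (conformalChange g F hF hpos) h (φ := φ) (fun x => a x • X x) p
      = (F p ^ 2 * a p) • curvatureTrace g h X p := by
  have hq := mem_extChartAt_source (I := 𝓡 n) (φ p)
  simp only [curvatureTrace]
  rw [← ofCoord_smul hq]
  congr 1
  rw [fieldCoord_smul a X (extChartAt_mem_chartDomain φ p), extChartAt_to_inv p]
  simp only [invMetricMatrix_conformalChange g hF hpos (mem_extChartAt_target p),
    exp_two_mul_logCoord_self hpos, Finset.smul_sum, smul_smul]
  refine Finset.sum_congr rfl fun i _ => Finset.sum_congr rfl fun j _ => ?_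
  ext d
  simp only [PiLp.smul_apply, smul_eq_mul, Finset.mul_sum]
  exact Finset.sum_congr rfl fun _ _ => Finset.sum_congr rfl fun _ _ =>
    Finset.sum_congr rfl fun _ _ => by ring

theorem covDeriv_grad (X : FieldAlong n φ) {f : M → ℝ} (hf : MDifferentiable (𝓡 m) 𝓘(ℝ, ℝ) f)
    (p : M) : covDeriv h X p (grad g f p) = ofCoord (φ p) (φ p) (∑ k,
      gradCoord g p (f ∘ (extChartAt (𝓡 m) p).symm) (extChartAt (𝓡 m) p p) k •
        covDerivCoord h φ p k (fieldCoord X p) (extChartAt (𝓡 m) p p)) := by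
  rw [covDeriv, toCoord_grad_self g hf]

/-- The rough Laplacian, with respect to the conformal metric `F⁻² g`, of `c F² X`. -/
theorem roughLaplacian_conformalChange_smul (hφ : ContMDiff (𝓡 m) (𝓡 n) ∞ φ)
    (hF : ContMDiff (𝓡 m) 𝓘(ℝ, ℝ) ∞ F) (hpos : ∀ x, 0 < F x) (c : ℝ) (X : FieldAlong n φ) (p : M)
    (hX : ContDiffOn ℝ ∞ (fieldCoord X p) (chartDomain (m := m) (n := n) φ p)) :
    roughLaplacian (conformalChange g F hF hpos) h (φ := φ) (fun x => (c * F x ^ 2) • X x) p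
      = (c * F p ^ 4) • (roughLaplacian g h X p
        - ((m : ℝ) - 6) • covDeriv h X p (grad g (Real.log ∘ F) p)
        + (2 * (laplacian g (Real.log ∘ F) p - ((m : ℝ) - 4) *
            g.inner p (grad g (Real.log ∘ F) p) (grad g (Real.log ∘ F) p))) • X p) := by
  have hq := mem_extChartAt_source (I := 𝓡 n) (φ p)
  have hlog := contMDiff_log_comp hF hpos
  have hy := extChartAt_mem_chartDomain (m := m) (n := n) φ p
  have hU := isOpen_chartDomain (m := m) (n := n) hφ.continuous p
  have hf : ContDiffOn ℝ ∞ (logCoord F p) (chartDomain (m := m) (n := n) φ p) :=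
    (contDiffOn_comp_extChartAt_symm hlog p).mono Set.inter_subset_left
  have hY {y : EuclideanSpace ℝ (Fin m)} (hy : y ∈ chartDomain (m := m) (n := n) φ p) :
      fieldCoord (φ := φ) (fun x => (c * F x ^ 2) • X x) p =ᶠ[𝓝 y]
        fun z => (c * Real.exp (2 * logCoord F p z)) • fieldCoord X p z :=
    eventually_of_mem (hU.mem_nhds hy) fun z hz => by
      simp only [fieldCoord_smul _ X hz, exp_two_mul_logCoord hpos]
  have hD (k : Fin m) {y : EuclideanSpace ℝ (Fin m)}
      (hy : y ∈ chartDomain (m := m) (n := n) φ p) := covDerivCoord_congr h φ p k (hY hy)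
  have hDD (i j : Fin m) := covDerivCoord_congr h φ p i
    (eventually_of_mem (hU.mem_nhds hy) fun z hz => hD j hz)
  rw [covDeriv_grad g h X (hlog.mdifferentiable (by simp)),
    inner_grad_grad g (hlog.mdifferentiable (by simp))]
  have hXp := ofCoord_fieldCoord_self (m := m) X p
  set Xp := X p
  rw [← hXp]
  simp only [roughLaplacian, laplacian]
  rw [← ofCoord_smul hq, ← ofCoord_smul hq, ← ofCoord_sub hq, ← ofCoord_add hq, ← ofCoord_smul hq]
  congr 1
  rw [sum_invMetricMatrix_smul_conformalChange g hF hpos (mem_extChartAt_target p),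
    exp_two_mul_logCoord_self hpos]
  simp only [hDD, hD _ hy, covDerivCoord_covDerivCoord_exp_smul h hφ hf hX c hy,
    covDerivCoord_exp_smul h hφ hf hX c hy, exp_two_mul_logCoord_self hpos]
  rw [sum_smul_leibniz (invMetricMatrix_symm g p _)]
  have hG (k : Fin m) (y : EuclideanSpace ℝ (Fin m)) : gradCoord g p (logCoord F p) y k
      = ∑ l, invMetricMatrix g p y k l * partialDeriv l (logCoord F p) y := rfl
  rw [sum_smul_smul_add]
  simp only [← hG]
  -- The coefficients combine as 4 - (m-2) = -(m-6) for the first-order term and 4 - 2(m-2) =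
  -- -2(m-4) for |grad f|².
  module

theorem bitension_conformalChange (hφ : ContMDiff (𝓡 m) (𝓡 n) ∞ φ) (hharm : IsHarmonic g h φ)
    (hF : ContMDiff (𝓡 m) 𝓘(ℝ, ℝ) ∞ F) (hpos : ∀ x, 0 < F x) (p : M) :
    bitension (conformalChange g F hF hpos) h φ p
      = (((m : ℝ) - 2) * F p ^ 4) • (jacobi g h (pushGrad g φ (Real.log ∘ F)) p
          + ((m : ℝ) - 6) •
            covDeriv h (pushGrad g φ (Real.log ∘ F)) p (grad g (Real.log ∘ F) p)
          - (2 * (laplacian g (Real.log ∘ F) p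
              - ((m : ℝ) - 4) *
                g.inner p (grad g (Real.log ∘ F) p) (grad g (Real.log ∘ F) p))) •
            pushGrad g φ (Real.log ∘ F) p) := by
  -- Harmonicity is used at every point: the rough Laplacian requires an identity of fields, not
  -- just one at p.
  have ht : tension (conformalChange g F hF hpos) h φ
      = fun x => (-((m : ℝ) - 2) * F x ^ 2) • pushGrad g φ (Real.log ∘ F) x := by
    funext x
    rw [tension_conformalChange g h hφ, hharm x]
    module
  rw [bitension, ht, curvatureTrace_conformalChange_smul,
    roughLaplacian_conformalChange_smul g h hφ hF hpos _ _ p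
      (contDiffOn_fieldCoord_pushGrad g hφ (contMDiff_log_comp hF hpos) p), jacobi]
  module

end FieldsAlong

end RiemannianMaps

end

open RiemannianMaps in
theorem mainTheorem6 {m n : ℕ} (hm : m ≠ 2) {M N : Type*}
    [TopologicalSpace M] [ChartedSpace (EuclideanSpace ℝ (Fin m)) M] [IsManifold (𝓡 m) ∞ M]
    [TopologicalSpace N] [ChartedSpace (EuclideanSpace ℝ (Fin n)) N] [IsManifold (𝓡 n) ∞ N]
    (g : Metric m M) (h : Metric n N)
    (φ : M → N) (hφ : ContMDiff (𝓡 m) (𝓡 n) ∞ φ) (hharm : IsHarmonic g h φ)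
    (F : M → ℝ) (hF : ContMDiff (𝓡 m) 𝓘(ℝ, ℝ) ∞ F) (hpos : ∀ x, 0 < F x) :
    IsBiharmonic (conformalChange g F hF hpos) h φ ↔
      ∀ p : M,
        jacobi g h (pushGrad g φ (Real.log ∘ F)) p
          + ((m : ℝ) - 6) •
            covDeriv h (pushGrad g φ (Real.log ∘ F)) p (grad g (Real.log ∘ F) p)
          - (2 * (laplacian g (Real.log ∘ F) p
              - ((m : ℝ) - 4) *
                g.inner p (grad g (Real.log ∘ F) p) (grad g (Real.log ∘ F) p))) •
            pushGrad g φ (Real.log ∘ F) p = 0 := by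
  -- Here m ≠ 2 enters: for m = 2 harmonicity is conformally invariant and this factor is zero.
  have hc (p : M) : ((m : ℝ) - 2) * F p ^ 4 ≠ 0 :=
    mul_ne_zero (sub_ne_zero.2 (by exact_mod_cast hm)) (pow_pos (hpos p) 4).ne'
  simp only [IsBiharmonic, bitension_conformalChange g h hφ hharm hF hpos, smul_eq_zero, hc,
    false_or]
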